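/- Let $n\ge 1$ and let $\mathcal L^n$ denote Lebesgue outer measure on $\mathbb R^n$. For $A,B\subset\mathbb R^n$ write $A\sim B$ if $\mathcal L^n(A\setminus B)=\mathcal L^n(B\setminus A)=0$. For $A\subset\mathbb R^n$ and a real number $m\ge n$, let $$A^{(m)}:=\Big\{x\in\mathbb R^n \;:\; \lim_{r\to0^+}\frac{\mathcal L^n(B(x,r)\setminus A)}{r^m}=0\Big\},$$ where $B(x,r)$ is the open ball of radius $r$ centred at $x$. The density-degree function $d_A:\mathbb R^n\to[0,+\infty]$ of $A$ is $$d_A(x):=\begin{cases}\sup\{m\in[n,+\infty) : x\in A^{(m)}\}&\text{if }x\in A^{(n)},\\ 0&\text{if }x\notin A^{(n)}.\end{cases}$$ The set $A$ is called uniformly $n$-dense if $A\sim\{x\in\mathbb R^n : d_A(x)=n\}$. **Corollary 5.1.** Let $E$ be a Lebesgue measurable subset of $\mathbb R^n$. Then there exists an increasing sequence $F_1\subset F_2\subset\cdots$ of uniformly $n$-dense closed subsets of $\mathbb R^n$ such that $\bigcup_{l}F_l\sim E$. -/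

import Mathlib

open MeasureTheory Filter Topology
open scoped ENNReal

namespace DensityDegree

/-- The set `E^{(m)}` of `m`-density points of `E ⊆ ℝⁿ`: those `x` for which
`ℒⁿ(B(x, r) ∖ E) / r^m → 0` as `r → 0⁺`. The set `E` is arbitrary; `volume` of a set that need not
be measurable is its Lebesgue outer measure. -/
def densityPoints {n : ℕ} (m : ℝ) (E : Set (EuclideanSpace ℝ (Fin n))) :
    Set (EuclideanSpace ℝ (Fin n)) :=
  {x | Tendsto (fun r : ℝ => volume (Metric.ball x r \ E) / ENNReal.ofReal (r ^ m))
    (𝓝[>] (0 : ℝ)) (𝓝 0)}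

open Classical in
/-- The density-degree function `d_E : ℝⁿ → [0, +∞]`: the supremum of all real `m ≥ n` such that
`x ∈ E^{(m)}` when `x ∈ E^{(n)}`, and `0` when `x ∉ E^{(n)}`. -/
noncomputable def densityDegree {n : ℕ} (E : Set (EuclideanSpace ℝ (Fin n)))
    (x : EuclideanSpace ℝ (Fin n)) : ℝ≥0∞ :=
  if x ∈ densityPoints (n : ℝ) E then
    sSup (ENNReal.ofReal '' {m : ℝ | (n : ℝ) ≤ m ∧ x ∈ densityPoints m E})
  else 0

/-- `E ⊆ ℝⁿ` is uniformly `k`-dense, for `k ∈ [n, +∞]`: the sets `E` and `{x | d_E(x) = k}` are equal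
up to a Lebesgue null set. -/
def IsUniformlyDense {n : ℕ} (k : ℝ≥0∞) (E : Set (EuclideanSpace ℝ (Fin n))) : Prop :=
  (n : ℝ≥0∞) ≤ k ∧ E =ᵐ[volume] {x | densityDegree E x = k}

end DensityDegree

namespace DensityDegree

open Metric Set

/-! Around the hyperplanes of one coordinate lying in `2⁻ʲ ℤ`, take open slabs of half-width `2⁻ʲ /
(j + 1)²`. The slabs of generation `j` have density of order `1 / (j + 1)²`, which is summable, so
by Borel–Cantelli almost every point lies in only finitely many generations. Removing generations `j
≥ l` from the `l`-th set of a closed exhaustion of `E` thus loses only a null set in the union. At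
radius `r ≈ 2⁻ʲ` the slabs nevertheless fill at least `r ^ n` divided by a power of `log (1 / r)` of
every ball, which is not `o(r ^ m)` for any `m > n`. Degrees above `n` are therefore excluded
everywhere, while Lebesgue density gives degree `n` almost everywhere on the set. -/

section DyadicSlabs

/-- The points of the circle whose `2 ^ j`-th multiple is within `1 / (j + 1) ^ 2` of zero. -/
def dyadicArc (j : ℕ) : Set UnitAddCircle :=
  (fun t => 2 ^ j • t) ⁻¹' ball 0 (1 / ((j : ℝ) + 1) ^ 2)

lemma isOpen_dyadicArc (j : ℕ) : IsOpen (dyadicArc j) :=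
  isOpen_ball.preimage (continuous_const_smul _)

/-- Multiplication by `2 ^ j` preserves Haar measure on the circle. -/
lemma volume_dyadicArc_le (j : ℕ) :
    volume (dyadicArc j) ≤ ENNReal.ofReal (2 * (1 / ((j : ℝ) + 1) ^ 2)) := by
  have hmp : MeasurePreserving (fun t : UnitAddCircle => 2 ^ j • t) volume volume := by
    -- Ergodicity needs a multiplier greater than `1`, so `j = 0` is treated apart.
    rcases Nat.eq_zero_or_pos j with rfl | hj
    · simpa using! MeasurePreserving.id (volume : Measure UnitAddCircle)
    · exact (AddCircle.ergodic_nsmul (Nat.one_lt_two_pow hj.ne')).toMeasurePreserving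
  rw [dyadicArc, hmp.measure_preimage measurableSet_ball.nullMeasurableSet]
  refine (measure_mono ball_subset_closedBall).trans ?_
  rw [AddCircle.volume_closedBall]
  exact ENNReal.ofReal_le_ofReal (min_le_right _ _)

lemma volume_limsup_dyadicArc : volume (limsup dyadicArc atTop) = 0 := by
  refine measure_limsup_atTop_eq_zero (ne_top_of_le_ne_top ?_
    (ENNReal.tsum_le_tsum volume_dyadicArc_le))
  refine Summable.tsum_ofReal_ne_top (Summable.mul_left 2 ?_)
  exact_mod_cast (summable_nat_add_iff 1).2 (Real.summable_one_div_nat_pow.2 one_lt_two)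

/-- Transfers the null limsup from the circle to the line; nullity is local, so one period around
each point suffices. -/
lemma quasiMeasurePreserving_coe_unitAddCircle :
    Measure.QuasiMeasurePreserving ((↑) : ℝ → UnitAddCircle) volume volume := by
  refine ⟨AddCircle.measurable_mk', Measure.AbsolutelyContinuous.mk fun s hs h0 => ?_⟩
  rw [Measure.map_apply AddCircle.measurable_mk' hs]
  refine measure_null_of_locally_null _ fun x _ => ?_
  refine ⟨((↑) : ℝ → UnitAddCircle) ⁻¹' s ∩ Ioc (x - 1 / 2) (x - 1 / 2 + 1),
    inter_mem_nhdsWithin _ (Ioc_mem_nhds (by linarith) (by linarith)), ?_⟩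
  rw [← Measure.restrict_apply (AddCircle.measurable_mk' hs),
    (UnitAddCircle.measurePreserving_mk _).measure_preimage hs.nullMeasurableSet, h0]

variable {n : ℕ}

/-- The union over `j ≥ l` of the slabs of points whose `i`-th coordinate is within
`2⁻ʲ / (j + 1) ^ 2` of `2⁻ʲ ℤ`. -/
def slabUnion (i : Fin n) (l : ℕ) : Set (EuclideanSpace ℝ (Fin n)) :=
  ⋃ j ≥ l, (fun x => ((x i : ℝ) : UnitAddCircle)) ⁻¹' dyadicArc j

lemma isOpen_slabUnion (i : Fin n) (l : ℕ) : IsOpen (slabUnion i l) := by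
  refine isOpen_biUnion fun j _ => (isOpen_dyadicArc j).preimage ?_
  exact (AddCircle.continuous_mk' 1).comp (by fun_prop)

lemma antitone_slabUnion (i : Fin n) : Antitone (slabUnion i) := fun _ _ h =>
  biUnion_subset_biUnion_left fun _ hj => h.trans hj

lemma volume_iInter_slabUnion (i : Fin n) : volume (⋂ l, slabUnion i l) = 0 := by
  have hq : Measure.QuasiMeasurePreserving
      (fun x : EuclideanSpace ℝ (Fin n) => ((x i : ℝ) : UnitAddCircle)) volume volume :=
    quasiMeasurePreserving_coe_unitAddCircle.comp
      ((Measure.quasiMeasurePreserving_eval (fun _ : Fin n => (volume : Measure ℝ)) i).comp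
        (PiLp.volume_preserving_ofLp (Fin n)).quasiMeasurePreserving)
  refine measure_mono_null (fun x hx => ?_) (hq.preimage_null volume_limsup_dyadicArc)
  simp only [slabUnion, mem_iInter, mem_iUnion, mem_preimage] at hx
  rw [mem_preimage, limsup_eq_iInf_iSup_of_nat]
  simpa using hx

/-- At every dyadic scale below `2⁻ˡ`, balls of twice that radius contain a fairly large ball
lying in `slabUnion i l`. -/
lemma exists_ball_subset_slabUnion (i : Fin n) {l j : ℕ} (hj : l ≤ j)
    (x : EuclideanSpace ℝ (Fin n)) :
    ∃ y, ball y ((1 / 2) ^ j / ((j : ℝ) + 1) ^ 2) ⊆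
      ball x (2 * (1 / 2) ^ j) ∩ slabUnion i l := by
  -- `y` is `x` with its `i`-th coordinate moved to the nearest point of `2⁻ʲ ℤ`.
  set k : ℤ := round (2 ^ j * x i)
  set y : EuclideanSpace ℝ (Fin n) :=
    x + EuclideanSpace.single i ((1 / 2) ^ j * k - x i) with hy
  have hpow : (2 : ℝ) ^ j * (1 / 2) ^ j = 1 := by rw [← mul_pow]; norm_num
  have hpos : (0 : ℝ) < (1 / 2) ^ j := by positivity
  have hyi : y i = (1 / 2) ^ j * k := by simp [hy]
  have hround : |2 ^ j * x i - k| ≤ 1 / 2 := abs_sub_round _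
  have hdist : dist y x ≤ (1 / 2) ^ j := by
    have h : (1 / 2) ^ j * k - x i = -((1 / 2) ^ j * (2 ^ j * x i - k)) := by
      linear_combination (x i) * hpow
    rw [hy, dist_eq_norm, add_sub_cancel_left, PiLp.norm_single, h, norm_neg, norm_mul,
      Real.norm_eq_abs, Real.norm_eq_abs, abs_of_pos hpos]
    nlinarith
  have hsq : (1 : ℝ) ≤ ((j : ℝ) + 1) ^ 2 := one_le_pow₀ (by simp)
  refine ⟨y, fun z hz => ⟨?_, ?_⟩⟩
  · rw [mem_ball] at hz ⊢
    have : (1 / 2 : ℝ) ^ j / ((j : ℝ) + 1) ^ 2 ≤ (1 / 2) ^ j := div_le_self hpos.le hsq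
    linarith [dist_triangle z y x]
  · refine mem_biUnion (show j ∈ {j | j ≥ l} from hj) ?_
    have hzi : |z i - y i| < (1 / 2) ^ j / ((j : ℝ) + 1) ^ 2 := by
      refine lt_of_le_of_lt ?_ (mem_ball_iff_norm.1 hz)
      simpa using PiLp.norm_apply_le (z - y) i
    have hcoe : (2 ^ j • ((z i : ℝ) : UnitAddCircle)) =
        ((2 ^ j * (z i - y i) : ℝ) : UnitAddCircle) := by
      rw [hyi, mul_sub, ← mul_assoc, hpow, one_mul, AddCircle.coe_sub]
      have : ((k : ℝ) : UnitAddCircle) = 0 := (AddCircle.coe_eq_zero_iff (1 : ℝ)).2 ⟨k, by simp⟩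
      rw [this, sub_zero, ← AddCircle.coe_nsmul, nsmul_eq_mul]
      norm_cast
    rw [mem_preimage, dyadicArc, mem_preimage, mem_ball_zero_iff, hcoe]
    refine lt_of_le_of_lt QuotientAddGroup.norm_mk_le_norm ?_
    rw [norm_mul, Real.norm_eq_abs, Real.norm_eq_abs, abs_of_pos (by positivity : (0 : ℝ) < 2 ^ j)]
    calc (2 : ℝ) ^ j * |z i - y i| < 2 ^ j * ((1 / 2) ^ j / ((j : ℝ) + 1) ^ 2) := by gcongr
      _ = 1 / ((j : ℝ) + 1) ^ 2 := by rw [← mul_div_assoc, hpow]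

end DyadicSlabs

section Density

variable {n : ℕ}

/-- The surplus factor `2 ^ (-j (m - n))` beats the polynomial `(j + 1) ^ (2 n)`. -/
lemma eventually_rpow_le_pow {m : ℝ} (hm : n < m) :
    ∀ᶠ j : ℕ in atTop,
      (2 * (1 / 2 : ℝ) ^ j) ^ m ≤ ((1 / 2) ^ j / ((j : ℝ) + 1) ^ 2) ^ n := by
  set s : ℝ := m - n
  have hs0 : 0 < s := sub_pos.2 hm
  have hρ : |(1 / 2 : ℝ) ^ s| < 1 := by
    rw [abs_of_pos (by positivity)]
    exact Real.rpow_lt_one (by norm_num) (by norm_num) hs0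
  have hlim := ((tendsto_pow_const_mul_const_pow_of_abs_lt_one (2 * n) hρ).comp
    (tendsto_add_atTop_nat 1)).const_mul (2 ^ n * (4 : ℝ) ^ s)
  rw [mul_zero] at hlim
  filter_upwards [hlim.eventually (ge_mem_nhds zero_lt_one)] with j hj
  simp only [Function.comp_apply, Nat.cast_add, Nat.cast_one] at hj
  have hpos : (0 : ℝ) < 2 * (1 / 2) ^ j := by positivity
  have hsplit : (2 * (1 / 2 : ℝ) ^ j) ^ m
      = (2 * (1 / 2 : ℝ) ^ j) ^ n * (4 ^ s * ((1 / 2 : ℝ) ^ s) ^ (j + 1)) := by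
    have h4 : 2 * (1 / 2 : ℝ) ^ j = 4 * (1 / 2) ^ (j + 1) := by ring
    have hm' : m = n + s := by ring
    rw [hm', Real.rpow_add hpos, Real.rpow_natCast, h4, Real.mul_rpow (by norm_num) (by positivity),
      Real.rpow_pow_comm (by norm_num)]
  rw [hsplit, div_pow _ (((j : ℝ) + 1) ^ 2), ← pow_mul ((j : ℝ) + 1), le_div_iff₀ (by positivity)]
  calc _ = ((1 / 2 : ℝ) ^ j) ^ n *
        (2 ^ n * 4 ^ s * (((j : ℝ) + 1) ^ (2 * n) * ((1 / 2 : ℝ) ^ s) ^ (j + 1))) := by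
        rw [mul_pow]; ring
    _ ≤ _ := mul_le_of_le_one_right (by positivity) hj

lemma notMem_densityPoints_of_disjoint_slabUnion {F : Set (EuclideanSpace ℝ (Fin n))} (i : Fin n)
    {l : ℕ} (hF : Disjoint F (slabUnion i l)) {m : ℝ} (hm : n < m)
    (x : EuclideanSpace ℝ (Fin n)) : x ∉ densityPoints m F := by
  intro hx
  have hr : Tendsto (fun j : ℕ => 2 * (1 / 2 : ℝ) ^ j) atTop (𝓝[>] 0) := by
    refine tendsto_nhdsWithin_iff.2 ⟨?_, Eventually.of_forall fun j => by simp⟩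
    simpa using (tendsto_pow_atTop_nhds_zero_of_lt_one (r := (1 / 2 : ℝ)) (by norm_num)
      (by norm_num)).const_mul 2
  have hω : 0 < volume (ball (0 : EuclideanSpace ℝ (Fin n)) 1) := measure_ball_pos _ _ one_pos
  refine hω.not_ge (ge_of_tendsto (Tendsto.comp hx hr) ?_)
  filter_upwards [eventually_rpow_le_pow hm, eventually_ge_atTop l] with j hj hlj
  obtain ⟨y, hy⟩ := exists_ball_subset_slabUnion i hlj x
  have hpos : (0 : ℝ) < (2 * (1 / 2) ^ j) ^ m := by positivity
  rw [Function.comp_apply, ENNReal.le_div_iff_mul_le (Or.inl (ENNReal.ofReal_pos.2 hpos).ne')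
    (Or.inl ENNReal.ofReal_ne_top)]
  calc _ = ENNReal.ofReal ((2 * (1 / 2) ^ j) ^ m) * volume (ball (0 : EuclideanSpace ℝ (Fin n)) 1) :=
        mul_comm _ _
    _ ≤ ENNReal.ofReal (((1 / 2) ^ j / ((j : ℝ) + 1) ^ 2) ^ n) *
          volume (ball (0 : EuclideanSpace ℝ (Fin n)) 1) := by gcongr
    _ = volume (ball y ((1 / 2) ^ j / ((j : ℝ) + 1) ^ 2)) := by
        rw [Measure.addHaar_ball_of_pos _ y (by positivity), finrank_euclideanSpace_fin]
    _ ≤ volume (ball x (2 * (1 / 2) ^ j) \ F) := measure_mono fun z hz =>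
        ⟨(hy hz).1, fun hzF => hF.notMem_of_mem_left hzF (hy hz).2⟩

lemma volume_closedBall_eq (x : EuclideanSpace ℝ (Fin n)) {r : ℝ} (hr : 0 < r) :
    volume (closedBall x r) = ENNReal.ofReal (r ^ (n : ℝ)) *
      volume (ball (0 : EuclideanSpace ℝ (Fin n)) 1) := by
  rw [Measure.addHaar_closedBall _ x hr.le, finrank_euclideanSpace_fin, Real.rpow_natCast]

/-- The **Lebesgue density theorem** in terms of `densityPoints`. -/
lemma ae_mem_densityPoints {F : Set (EuclideanSpace ℝ (Fin n))} (hF : MeasurableSet F) :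
    ∀ᵐ x, x ∈ F → x ∈ densityPoints (n : ℝ) F := by
  filter_upwards [Besicovitch.ae_tendsto_measure_inter_div_of_measurableSet volume hF.compl]
    with x hx hxF
  rw [indicator_of_notMem (by simpa using hxF)] at hx
  have hω : volume (ball (0 : EuclideanSpace ℝ (Fin n)) 1) ≠ ∞ := measure_ball_lt_top.ne
  have hω0 : volume (ball (0 : EuclideanSpace ℝ (Fin n)) 1) ≠ 0 :=
    (measure_ball_pos _ _ one_pos).ne'
  -- Passes from normalisation by ball volume to normalisation by `r ^ n`.
  have hlim := ENNReal.Tendsto.mul_const (b := volume (ball (0 : EuclideanSpace ℝ (Fin n)) 1))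
    hx (Or.inr hω)
  rw [zero_mul] at hlim
  refine tendsto_of_tendsto_of_tendsto_of_le_of_le' tendsto_const_nhds hlim
    (Eventually.of_forall fun _ => zero_le) ?_
  filter_upwards [self_mem_nhdsWithin] with r hr
  rw [volume_closedBall_eq x hr]
  calc volume (ball x r \ F) / ENNReal.ofReal (r ^ (n : ℝ))
      ≤ volume (Fᶜ ∩ closedBall x r) / ENNReal.ofReal (r ^ (n : ℝ)) := by
        gcongr
        exact fun z hz => ⟨hz.2, ball_subset_closedBall hz.1⟩
    _ = volume (Fᶜ ∩ closedBall x r) * volume (ball (0 : EuclideanSpace ℝ (Fin n)) 1) /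
        (ENNReal.ofReal (r ^ (n : ℝ)) * volume (ball (0 : EuclideanSpace ℝ (Fin n)) 1)) :=
        (ENNReal.mul_div_mul_right _ _ hω0 hω).symm
    _ = _ := ENNReal.mul_div_right_comm

lemma notMem_densityPoints_of_notMem {F : Set (EuclideanSpace ℝ (Fin n))} (hF : IsClosed F)
    {x : EuclideanSpace ℝ (Fin n)} (hx : x ∉ F) : x ∉ densityPoints (n : ℝ) F := by
  intro h
  have hω : 0 < volume (ball (0 : EuclideanSpace ℝ (Fin n)) 1) := measure_ball_pos _ _ one_pos
  obtain ⟨ε, hε, hball⟩ := Metric.isOpen_iff.1 hF.isOpen_compl x hx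
  refine hω.not_ge (ge_of_tendsto h ?_)
  filter_upwards [Ioo_mem_nhdsGT hε] with r hr
  have hpos : 0 < r ^ (n : ℝ) := Real.rpow_pos_of_pos hr.1 _
  have hdiff : ball x r \ F = ball x r :=
    sdiff_eq_left.2 (disjoint_left.2 fun z hz hzF => hball (ball_subset_ball hr.2.le hz) hzF)
  rw [hdiff, ENNReal.le_div_iff_mul_le (Or.inl (ENNReal.ofReal_pos.2 hpos).ne')
    (Or.inl ENNReal.ofReal_ne_top),
    Measure.addHaar_ball_of_pos _ x hr.1, finrank_euclideanSpace_fin, Real.rpow_natCast, mul_comm]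

lemma isUniformlyDense_of_disjoint_slabUnion {F : Set (EuclideanSpace ℝ (Fin n))}
    (hF : IsClosed F) (i : Fin n) {l : ℕ} (hd : Disjoint F (slabUnion i l)) :
    IsUniformlyDense (n : ℝ≥0∞) F := by
  refine ⟨le_rfl, ?_⟩
  filter_upwards [ae_mem_densityPoints hF.measurableSet] with x hx
  refine propext ⟨fun hxF => ?_, fun hdeg => ?_⟩
  · have hset : {m : ℝ | (n : ℝ) ≤ m ∧ x ∈ densityPoints m F} = {(n : ℝ)} := by
      ext m
      refine ⟨fun ⟨h1, h2⟩ => ?_, ?_⟩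
      · by_contra hne
        exact notMem_densityPoints_of_disjoint_slabUnion i hd
          (lt_of_le_of_ne h1 (Ne.symm hne)) x h2
      · rintro rfl
        exact ⟨le_rfl, hx hxF⟩
    change densityDegree F x = n
    rw [densityDegree, if_pos (hx hxF), hset]
    simp
  -- Off the closed set the degree is `0`, and `n ≠ 0` because `Fin n` has the element `i`.
  · by_contra hxF
    change densityDegree F x = n at hdeg
    rw [densityDegree, if_neg (notMem_densityPoints_of_notMem hF hxF)] at hdeg
    exact (Nat.cast_ne_zero.2 (Nat.pos_iff_ne_zero.1 i.pos)) hdeg.symm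

/-- A measurable set is exhausted, up to a null set, by an increasing sequence of closed subsets. -/
lemma exists_monotone_isClosed_iUnion_ae_eq {E : Set (EuclideanSpace ℝ (Fin n))}
    (hE : MeasurableSet E) :
    ∃ K : ℕ → Set (EuclideanSpace ℝ (Fin n)),
      Monotone K ∧ (∀ l, IsClosed (K l)) ∧ (⋃ l, K l) =ᵐ[volume] E := by
  have hC : ∀ k : ℕ, ∃ C ⊆ E ∩ ball 0 k, IsClosed C ∧
      volume ((E ∩ ball 0 k) \ C) < ENNReal.ofReal (1 / ((k : ℝ) + 1)) := fun k =>
    (hE.inter measurableSet_ball).exists_isClosed_sdiff_lt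
      (measure_ne_top_of_subset inter_subset_right measure_ball_lt_top.ne)
      (by simp only [ne_eq, ENNReal.ofReal_eq_zero, not_le]; positivity)
  choose C hCE hCcl hCvol using hC
  refine ⟨accumulate C, monotone_accumulate, fun l => ?_, ?_⟩
  · exact (finite_Iic l).isClosed_biUnion fun k _ => hCcl k
  rw [iUnion_accumulate]
  refine (ae_eq_set.2 ⟨?_, ?_⟩)
  · rw [sdiff_eq_empty.2 (iUnion_subset fun k => (hCE k).trans inter_subset_left), measure_empty]
  have hcover : E \ ⋃ k, C k ⊆ ⋃ N : ℕ, (E ∩ ball 0 N) \ ⋃ k, C k := fun x hx => by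
    obtain ⟨N, hN⟩ := exists_nat_gt ‖x‖
    exact mem_iUnion.2 ⟨N, ⟨hx.1, by simpa using hN⟩, hx.2⟩
  refine measure_mono_null hcover (measure_iUnion_null fun N => ?_)
  have hlim : Tendsto (fun k : ℕ => ENNReal.ofReal (1 / ((k : ℝ) + 1))) atTop (𝓝 0) := by
    simpa using ENNReal.tendsto_ofReal tendsto_one_div_add_atTop_nhds_zero_nat
  refine le_antisymm (ge_of_tendsto hlim ?_) (zero_le)
  filter_upwards [eventually_ge_atTop N] with k hk
  refine (measure_mono fun x hx => ?_).trans (hCvol k).le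
  exact ⟨⟨hx.1.1, ball_subset_ball (Nat.cast_le.2 hk) hx.1.2⟩,
    fun h => hx.2 (mem_iUnion_of_mem k h)⟩

end Density

end DensityDegree

theorem corollary5p1 (n : ℕ) (hn : 1 ≤ n) (E : Set (EuclideanSpace ℝ (Fin n)))
    (hE : NullMeasurableSet E volume) :
    ∃ F : ℕ → Set (EuclideanSpace ℝ (Fin n)),
      Monotone F ∧
      (∀ l, IsClosed (F l)) ∧
      (∀ l, DensityDegree.IsUniformlyDense (n : ℝ≥0∞) (F l)) ∧
      (⋃ l, F l) =ᵐ[volume] E := by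
  obtain ⟨E', -, hE', hEE'⟩ := hE.exists_measurable_subset_ae_eq
  obtain ⟨K, hKmono, hKcl, hK⟩ := DensityDegree.exists_monotone_isClosed_iUnion_ae_eq hE'
  let i : Fin n := ⟨0, hn⟩
  have hcl : ∀ l, IsClosed (K l \ DensityDegree.slabUnion i l) := fun l =>
    (hKcl l).sdiff (DensityDegree.isOpen_slabUnion i l)
  refine ⟨fun l => K l \ DensityDegree.slabUnion i l, fun a b hab => ?_, hcl, fun l => ?_, ?_⟩
  · exact Set.sdiff_subset_sdiff (hKmono hab) (DensityDegree.antitone_slabUnion i hab)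
  · exact DensityDegree.isUniformlyDense_of_disjoint_slabUnion (hcl l) i Set.disjoint_sdiff_left
  refine EventuallyEq.trans ?_ (hK.trans hEE')
  have hnull := measure_eq_zero_iff_ae_notMem.1 (DensityDegree.volume_iInter_slabUnion i)
  filter_upwards [hnull] with x hx
  refine propext ⟨fun h => ?_, fun h => ?_⟩
  · obtain ⟨l, hl⟩ := Set.mem_iUnion.1 h
    exact Set.mem_iUnion_of_mem l hl.1
  · obtain ⟨a, ha⟩ := Set.mem_iUnion.1 h
    simp only [Set.mem_iInter, not_forall] at hx
    obtain ⟨b, hb⟩ := hx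
    -- From stage `a` on, `x` is in the exhaustion; from stage `b` on, it avoids the removed slabs.
    exact Set.mem_iUnion_of_mem (max a b) ⟨hKmono (le_max_left a b) ha,
      fun h' => hb (DensityDegree.antitone_slabUnion i (le_max_right a b) h')⟩
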